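/- Call a pair $(a,b)$ of positive reals a pair of Coppersmith--Rivlin constants if for all integers $n\ge 0$, every real polynomial $p$ of degree $d\le n$ with $|p(k)|\le 1$ for all integers $k\in[0,n]$, and every $\delta>0$ with $n\ge\delta d^2$, we have $|p(x)|<a e^{b/\delta}$ for all real $x\in[0,n]$. Such pairs exist, and for every such pair $(a,b)$ there is a constant $c>0$ such that for all integers $0\le T<N$ and all real $\varepsilon$ the following holds. If some quantum network that makes $T$ queries to a list $X=(x_0,\dots,x_{N-1})$ of $N$ bits computes $\mathrm{OR}(X)=x_0\vee\dots\vee x_{N-1}$ with error probability at most $\varepsilon$ on every $X\in\{0,1\}^N$, then $$\varepsilon\ \ge\ c\,e^{-4bT^2/N-8T/\sqrt N}$$ (in short, $\varepsilon\in\Omega(e^{-4bT^2/N-8T/\sqrt N})$). The same bound holds if some such network solves the unordered search problem with error probability at most $\varepsilon$ on every $X$, that is, outputs a $j$ with $x_j=1$ if there is one, and the answer "no solution" if all $x_j$ are $0$. Here a quantum network with $T$ queries starts in $|\overline 0\rangle$, applies $U_T O U_{T-1} O\cdots O U_1 O U_0$, where the $U_i$ are arbitrary unitaries that do not depend on $X$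 and $O$ is the query gate $|j,b,z\rangle\mapsto|j,b\oplus x_j,z\rangle$ (basis states whose index register $j\ge N$ addresses no item are left unchanged), then the final state is observed in the computational basis, and the output is read off from the result. -/

import Mathlib

open scoped Matrix

/-- `(a, b)` is a pair of Coppersmith-Rivlin constants: `a` and `b` are positive, and whenever a
real polynomial `p` of degree `d ≤ n` satisfies `|p(k)| ≤ 1` at all integers `k ∈ [0, n]` and
`δ > 0` satisfies `n ≥ δ d²`, then `|p(x)| < a e^{b/δ}` for all real `x ∈ [0, n]`. -/
def IsCoppersmithRivlinPair (a b : ℝ) : Prop :=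
  0 < a ∧ 0 < b ∧
    ∀ (n d : ℕ) (p : Polynomial ℝ) (δ : ℝ), p.natDegree = d → d ≤ n →
      (∀ k : ℕ, k ≤ n → |p.eval (k : ℝ)| ≤ 1) →
      0 < δ → δ * (d : ℝ) ^ 2 ≤ (n : ℝ) →
      ∀ x : ℝ, 0 ≤ x → x ≤ (n : ℝ) → |p.eval x| < a * Real.exp (b / δ)

/-- Computational basis states `|j, b, z⟩` of a quantum network on `l + 1 + m` qubits: an index
register `j` of `l` qubits (read as a number in binary), an answer qubit `b`, and a workspace `z`
of `m` qubits. -/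
abbrev QBasis (l m : ℕ) : Type := Fin (2 ^ l) × Bool × (Fin m → Bool)

/-- The basis state `|0...0⟩`. -/
def QBasis.zero (l m : ℕ) : QBasis l m :=
  (⟨0, Nat.two_pow_pos l⟩, false, fun _ => false)

/-- The action of a query to the list `X` of `N` bits on basis states:
`|j, b, z⟩ ↦ |j, b ⊕ x_j, z⟩` for `j < N`.  Index values `j ≥ N`, which address no item, are
left unchanged. -/
def queryMap {N : ℕ} (X : Fin N → Bool) {l m : ℕ} (k : QBasis l m) : QBasis l m :=
  (k.1, (if h : k.1.val < N then xor k.2.1 (X ⟨k.1.val, h⟩) else k.2.1), k.2.2)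

/-- The query gate `O`, as a matrix: `O |k⟩ = |queryMap X k⟩`. -/
def queryGate {N : ℕ} (X : Fin N → Bool) (l m : ℕ) : Matrix (QBasis l m) (QBasis l m) ℂ :=
  Matrix.of fun k k' => if k = queryMap X k' then 1 else 0

/-- A quantum network with `T` queries to a list of `N` bits whose output is a value in `α`:
`T + 1` unitaries `U_0, ..., U_T` that do not depend on the list, and the rule `out` which reads
off the output from the basis state seen when the final state is observed. (For `α = Bool`, `out`
may in particular be one specific qubit of the network.) -/
structure QueryAlgorithm (N T : ℕ) (α : Type) where
  /-- number of qubits of the index register -/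
  l : ℕ
  /-- number of qubits of the workspace -/
  m : ℕ
  /-- the index register can address all items -/
  index_large : N ≤ 2 ^ l
  /-- the unitaries between the queries -/
  U : Fin (T + 1) → Matrix.unitaryGroup (QBasis l m) ℂ
  /-- the output rule -/
  out : QBasis l m → α

namespace QueryAlgorithm

variable {N T : ℕ} {α : Type}

/-- The state `U_t O U_{t-1} O ... O U_0 |0...0⟩` after `t` queries to `X`. -/
noncomputable def state (A : QueryAlgorithm N T α) (X : Fin N → Bool) :
    Fin (T + 1) → (QBasis A.l A.m → ℂ) :=
  Fin.induction
    ((A.U 0 : Matrix (QBasis A.l A.m) (QBasis A.l A.m) ℂ) *ᵥ Pi.single (QBasis.zero A.l A.m) 1)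
    (fun i ψ => (A.U i.succ : Matrix (QBasis A.l A.m) (QBasis A.l A.m) ℂ) *ᵥ
      (queryGate X A.l A.m *ᵥ ψ))

/-- The probability that the output of `A` on the list `X` lies in `S`, when the final state is
observed. -/
noncomputable def outputProb (A : QueryAlgorithm N T α) (X : Fin N → Bool) (S : Set α) : ℝ :=
  ∑ k, (A.out ⁻¹' S).indicator (fun k => ‖A.state X (Fin.last T) k‖ ^ 2) k

end QueryAlgorithm

/-- The OR of `N` bits. -/
def boolOr {N : ℕ} (X : Fin N → Bool) : Bool := decide (∃ j, X j = true)

/-- `A` computes OR with error probability at most `ε` on every list. -/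
def QueryAlgorithm.ComputesOr {N T : ℕ} (A : QueryAlgorithm N T Bool) (ε : ℝ) : Prop :=
  ∀ X : Fin N → Bool, A.outputProb X {v | v ≠ boolOr X} ≤ ε

/-- A correct answer to the search problem for `X`: an index `j` with `x_j = 1`, or the answer
`none` ("there is no solution") if all bits are `0`. -/
def IsSearchAnswer {N : ℕ} (X : Fin N → Bool) : Option (Fin N) → Prop
  | some j => X j = true
  | none => ∀ j, X j = false

/-- `A` searches the unordered list with error probability at most `ε` on every list. -/
def QueryAlgorithm.Searches {N T : ℕ} (A : QueryAlgorithm N T (Option (Fin N))) (ε : ℝ) : Prop :=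
  ∀ X : Fin N → Bool, A.outputProb X {v | ¬ IsSearchAnswer X v} ≤ ε

/-! After `T` queries every amplitude is a polynomial of degree at most `T` in the bits. Let `P`
project onto the outcomes with answer `false`. The overlap ⟨ψ₀|P|ψ_X⟩ with the fixed final state ψ₀
of the zero list also has degree at most `T`, whereas a probability would have degree `2T`. It is at
least 1 - ε at the zero list and, by Cauchy–Schwarz, at most √ε in modulus elsewhere. Symmetrization
turns it into a univariate q with q(0) ≥ 1 - ε and |q(k)| ≤ √ε for k = 1, ..., N. The
Coppersmith–Rivlin bound on [1, N] and Chebyshev growth over the last unit step to 0 bound q(0) by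
√ε times an exponential; squaring gives the claim.

Coppersmith–Rivlin pairs exist by interpolation at r consecutive integers near a maximum point of
|p|, where |p| = M. The interpolant is at most 8^r and the remainder at most max |p^(r)|, which a
weak Markov inequality makes at most M/2 once r is of order d²/n. Hence M ≤ 2·8^r. -/

/-! ### Interpolation remainder and Markov-type derivative bounds -/

open Polynomial in
/-- Generalized Rolle theorem: a polynomial with `r + 1` zeros has a zero of its `r`-th derivative
between them. -/
theorem Polynomial.exists_iterate_derivative_eq_zero_of_roots (r : ℕ) (f : ℝ[X]) (x : ℕ → ℝ)
    (a b : ℝ) (hx : ∀ i < r, x i < x (i + 1)) (hmem : ∀ i ≤ r, x i ∈ Set.Icc a b)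
    (hf : ∀ i ≤ r, f.eval (x i) = 0) :
    ∃ ξ ∈ Set.Icc a b, (derivative^[r] f).eval ξ = 0 := by
  induction r generalizing f x with
  | zero => exact ⟨x 0, hmem 0 le_rfl, by simpa using hf 0 le_rfl⟩
  | succ r ih =>
    have key : ∀ i, ∃ y, i ≤ r → y ∈ Set.Ioo (x i) (x (i + 1)) ∧ (derivative f).eval y = 0 := by
      intro i
      by_cases hi : i ≤ r
      · obtain ⟨y, hy, hy0⟩ := exists_deriv_eq_zero (f := fun t => f.eval t) (hx i (by omega))
          f.continuousOn (by rw [hf i (by omega), hf (i + 1) (by omega)])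
        exact ⟨y, fun _ => ⟨hy, by simpa using hy0⟩⟩
      · exact ⟨0, fun h => absurd h hi⟩
    choose y hy using key
    rw [Function.iterate_succ_apply]
    refine ih (derivative f) y (fun i hi => ?_) (fun i hi => ?_) (fun i hi => (hy i hi).2)
    · exact (hy i hi.le).1.2.trans (hy (i + 1) hi).1.1
    · exact ⟨(hmem i (by omega)).1.trans (hy i hi).1.1.le,
        (hy i hi).1.2.le.trans (hmem (i + 1) (by omega)).2⟩

open Polynomial in
/-- The remainder of Lagrange interpolation at the nodes `s`. -/
theorem Polynomial.exists_eval_sub_interpolate_eq (p : ℝ[X]) (s : Finset ℝ) (a b : ℝ)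
    (hs : ∀ v ∈ s, v ∈ Set.Icc a b) {x : ℝ} (hx : x ∈ Set.Icc a b) :
    ∃ ξ ∈ Set.Icc a b, p.eval x - (Lagrange.interpolate s id (fun v => p.eval v)).eval x =
      (derivative^[s.card] p).eval ξ / (s.card.factorial : ℝ) * ∏ v ∈ s, (x - v) := by
  classical
  set L := Lagrange.interpolate s id (fun v => p.eval v) with hL
  have hLs : ∀ v ∈ s, L.eval v = p.eval v := fun v hv =>
    Lagrange.eval_interpolate_at_node (v := id) _ (Set.injOn_id _) hv
  by_cases hxs : x ∈ s
  · exact ⟨x, hx, by rw [hLs x hxs, Finset.prod_eq_zero hxs (sub_self x)]; simp⟩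
  have hω : ∏ v ∈ s, (x - v) ≠ 0 :=
    Finset.prod_ne_zero_iff.2 fun v hv => sub_ne_zero.2 fun h => hxs (h ▸ hv)
  -- `K` makes `F` vanish at `x` as well as on `s`, giving the `s.card + 1` zeros that Rolle needs.
  set K := (p.eval x - L.eval x) / ∏ v ∈ s, (x - v) with hK
  set F : ℝ[X] := p - L - C K * Lagrange.nodal s id with hF
  have hFx : F.eval x = 0 := by
    simp only [hF, eval_sub, eval_mul, eval_C, Lagrange.eval_nodal, id]
    rw [hK, div_mul_cancel₀ _ hω, sub_self]
  have hFs : ∀ v ∈ s, F.eval v = 0 := by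
    intro v hv
    have := Lagrange.eval_nodal_at_node (v := (id : ℝ → ℝ)) hv
    simp only [id] at this
    simp [hF, hLs v hv, this]
  have hcard : (insert x s).card = s.card + 1 := Finset.card_insert_of_notMem hxs
  let e := (insert x s).orderEmbOfFin hcard
  have hes : ∀ i, e i ∈ insert x s := fun i => Finset.orderEmbOfFin_mem _ hcard i
  let y : ℕ → ℝ := fun i => if h : i < s.card + 1 then e ⟨i, h⟩ else 0
  have hy : ∀ i ≤ s.card, y i ∈ insert x s := by
    intro i hi
    simp only [y, dif_pos (Nat.lt_succ_of_le hi)]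
    exact hes _
  obtain ⟨ξ, hξ, h0⟩ := F.exists_iterate_derivative_eq_zero_of_roots s.card y a b
    (fun i hi => by
      simp only [y, dif_pos (show i < s.card + 1 by omega),
        dif_pos (show i + 1 < s.card + 1 by omega)]
      exact e.strictMono (by simp))
    (fun i hi => by
      rcases Finset.mem_insert.1 (hy i hi) with h | h
      · rw [h]; exact hx
      · exact hs _ h)
    (fun i hi => by
      rcases Finset.mem_insert.1 (hy i hi) with h | h
      · rw [h]; exact hFx
      · exact hFs _ h)
  refine ⟨ξ, hξ, ?_⟩
  have hL0 : derivative^[s.card] L = 0 :=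
    iterate_derivative_eq_zero_of_degree_lt (Lagrange.degree_interpolate_lt _ (Set.injOn_id _))
  have hN : derivative^[s.card] (Lagrange.nodal s (id : ℝ → ℝ)) = C (s.card.factorial : ℝ) := by
    have hd : (derivative^[s.card] (Lagrange.nodal s (id : ℝ → ℝ))).natDegree = 0 := by
      have := natDegree_iterate_derivative (Lagrange.nodal s (id : ℝ → ℝ)) s.card
      rw [Lagrange.natDegree_nodal] at this
      omega
    rw [eq_C_of_natDegree_eq_zero hd, coeff_iterate_derivative]
    have h1 := (Lagrange.nodal_monic (s := s) (v := (id : ℝ → ℝ))).coeff_natDegree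
    rw [Lagrange.natDegree_nodal] at h1
    simp [h1, Nat.descFactorial_self]
  have h1 : (derivative^[s.card] p).eval ξ = K * s.card.factorial := by
    rw [hF, iterate_derivative_sub, iterate_derivative_sub, iterate_derivative_C_mul, hL0, hN] at h0
    simp only [eval_sub, eval_mul, eval_C, sub_zero] at h0
    linarith
  have : (s.card.factorial : ℝ) ≠ 0 := by positivity
  rw [h1, mul_div_cancel_right₀ _ this, hK, div_mul_cancel₀ _ hω]

open Polynomial in
theorem Polynomial.iterate_derivative_comp_linear (p : ℝ[X]) (c e : ℝ) (k : ℕ) :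
    derivative^[k] (p.comp (C c * X + C e)) =
      C (c ^ k) * (derivative^[k] p).comp (C c * X + C e) := by
  induction k with
  | zero => simp
  | succ k ih =>
    rw [Function.iterate_succ_apply', ih, Function.iterate_succ_apply', derivative_C_mul,
      derivative_comp]
    simp only [derivative_add, derivative_C_mul, derivative_X, derivative_C, pow_succ, C_mul]
    ring

open Polynomial in
/-- Among polynomials bounded on an interval, the derivatives outside of the interval are largest
for Chebyshev polynomials. -/
theorem Polynomial.abs_eval_iterate_derivative_le_chebyshev (p : ℝ[X]) {d : ℕ}
    (hd : p.natDegree ≤ d) (k : ℕ) {c e M : ℝ} (hM : 0 ≤ M)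
    (hp : ∀ u ∈ Set.Icc (-1 : ℝ) 1, |p.eval (c * u + e)| ≤ M) {x : ℝ} (hx : 1 ≤ x) :
    |c| ^ k * |(derivative^[k] p).eval (c * x + e)| ≤
      M * (derivative^[k] (Chebyshev.T ℝ d)).eval x := by
  -- Normalizing by `A > M` and letting `A` tend to `M` covers `M = 0`.
  have main : ∀ A : ℝ, M < A → |c| ^ k * |(derivative^[k] p).eval (c * x + e)| ≤
      A * (derivative^[k] (Chebyshev.T ℝ d)).eval x := by
    intro A hA
    have hA0 : 0 < A := hM.trans_lt hA
    have key : ∀ σ : ℝ, |σ| = 1 → σ * (c ^ k * (derivative^[k] p).eval (c * x + e)) ≤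
        A * (derivative^[k] (Chebyshev.T ℝ d)).eval x := by
      intro σ hσ
      have h := Chebyshev.eval_iterate_derivative_le_of_forall_abs_le_one (n := d)
        (P := C (σ / A) * p.comp (C c * X + C e)) (k := k) hx
        (by
          refine natDegree_le_iff_degree_le.1 ((natDegree_C_mul_le _ _).trans ?_)
          refine natDegree_comp_le.trans ((Nat.mul_le_mul hd natDegree_linear_le).trans ?_)
          simp)
        (by
          intro u hu
          have := hp u hu
          simp only [eval_mul, eval_C, eval_comp, eval_add, eval_X]
          rw [abs_mul, abs_div, hσ, abs_of_pos hA0, one_div, inv_mul_le_iff₀ hA0]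
          linarith)
      rw [iterate_derivative_C_mul, iterate_derivative_comp_linear] at h
      simp only [eval_mul, eval_C, eval_comp, eval_add, eval_X] at h
      rw [div_mul_eq_mul_div, div_le_iff₀ hA0] at h
      linarith
    rw [← abs_pow, ← abs_mul]
    refine abs_le'.2 ⟨by simpa using key 1 (by simp), by simpa using key (-1) (by simp)⟩
  refine ge_of_tendsto (x := nhdsWithin M (Set.Ioi M)) (f := fun A => A *
    (derivative^[k] (Chebyshev.T ℝ d)).eval x) ?_
    (Filter.eventually_of_mem self_mem_nhdsWithin main)
  exact ((continuous_id.mul continuous_const).tendsto M).mono_left nhdsWithin_le_nhds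

-- The derivative is ∏ (d² - l²)/(2l + 1) over l < k, with 2l + 1 ≥ l + 1.
open Polynomial in
theorem Polynomial.Chebyshev.eval_iterate_derivative_T_one_le (d k : ℕ) :
    (derivative^[k] (T ℝ d)).eval 1 ≤ (d : ℝ) ^ (2 * k) / k.factorial := by
  by_cases hk : d < k
  · rw [iterate_derivative_eq_zero_of_degree_lt (by simp [hk])]
    simp only [eval_zero]
    positivity
  have h0 : ∀ j ∈ Finset.range k, (0 : ℝ) ≤ (d : ℝ) ^ 2 - (j : ℝ) ^ 2 := fun j hj => by
    have : (j : ℝ) ≤ d := by exact_mod_cast (by have := Finset.mem_range.1 hj; omega)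
    nlinarith [(Nat.cast_nonneg j : (0 : ℝ) ≤ j)]
  have hT := Chebyshev.iterate_derivative_T_eval_one_eq_div (𝔽 := ℝ) d k
  push_cast at hT
  rw [hT]
  refine div_le_div₀ (by positivity) ?_ (by positivity) ?_
  · calc ∏ l ∈ Finset.range k, ((d : ℝ) ^ 2 - (l : ℝ) ^ 2)
        ≤ ∏ l ∈ Finset.range k, (d : ℝ) ^ 2 :=
          Finset.prod_le_prod h0 fun j _ => by nlinarith [sq_nonneg (j : ℝ)]
      _ = (d : ℝ) ^ (2 * k) := by rw [Finset.prod_const, Finset.card_range, pow_mul]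
  · rw [← Finset.prod_range_add_one_eq_factorial]
    push_cast
    exact Finset.prod_le_prod (fun _ _ => by positivity) fun j _ => by
      linarith [(Nat.cast_nonneg j : (0 : ℝ) ≤ j)]

open Polynomial in
/-- A weak form of V. A. Markov's inequality on `[0, n]`. -/
theorem Polynomial.abs_eval_iterate_derivative_le (p : ℝ[X]) {d : ℕ} (hd : p.natDegree ≤ d) (k : ℕ)
    {n M : ℝ} (hn : 0 < n) (hp : ∀ u ∈ Set.Icc 0 n, |p.eval u| ≤ M) {x : ℝ}
    (hx : x ∈ Set.Icc 0 n) :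
    |(derivative^[k] p).eval x| ≤ M * ((4 * d ^ 2 / n) ^ k / k.factorial) := by
  have hM : 0 ≤ M := (abs_nonneg _).trans (hp x hx)
  -- Map [-1, 1] onto the longer of [0, x] and [x, n], with 1 going to x; its half-length is at
  -- least n/4.
  have main : ∃ c e : ℝ, c * 1 + e = x ∧ n / 4 ≤ |c| ∧
      ∀ u ∈ Set.Icc (-1 : ℝ) 1, c * u + e ∈ Set.Icc 0 n := by
    obtain ⟨h0, h1⟩ := hx
    rcases le_total x (n / 2) with h | h
    · refine ⟨-((n - x) / 2), x + (n - x) / 2, by ring, ?_, ?_⟩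
      · rw [abs_neg, abs_of_nonneg (by linarith)]; linarith
      · rintro u ⟨hu0, hu1⟩
        constructor <;> nlinarith
    · refine ⟨x / 2, x / 2, by ring, ?_, ?_⟩
      · rw [abs_of_nonneg (by linarith)]; linarith
      · rintro u ⟨hu0, hu1⟩
        constructor <;> nlinarith
  obtain ⟨c, e, rfl, hc, hce⟩ := main
  have h := p.abs_eval_iterate_derivative_le_chebyshev hd k hM (fun u hu => hp _ (hce u hu)) le_rfl
  have h2 := h.trans (mul_le_mul_of_nonneg_left
    (Chebyshev.eval_iterate_derivative_T_one_le d k) hM)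
  have h3 : (n / 4) ^ k * |(derivative^[k] p).eval (c * 1 + e)| ≤
      M * ((d : ℝ) ^ (2 * k) / k.factorial) :=
    (mul_le_mul_of_nonneg_right (pow_le_pow_left₀ (by positivity) hc k) (abs_nonneg _)).trans h2
  rw [← le_div_iff₀' (by positivity)] at h3
  refine h3.trans_eq ?_
  rw [show (4 * (d : ℝ) ^ 2 / n) = d ^ 2 / (n / 4) by field_simp, div_pow ((d : ℝ) ^ 2), ← pow_mul]
  field_simp

/-! ### Growth of polynomials between integer points -/

/-- Bound for the product of the distances from `t` to the integers `0, ..., r - 1`, in which one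
factor may be left out. -/
theorem prod_abs_sub_le_factorial {r : ℕ} {t : ℝ} (h0 : 0 ≤ t) (h1 : t < r) (s : Finset ℕ)
    (hs : s ⊆ Finset.range r) : ∏ j ∈ s, |t - j| ≤ (r.factorial : ℝ) := by
  set m := ⌊t⌋₊ with hm
  have hmt : (m : ℝ) ≤ t := Nat.floor_le h0
  have htm : t < m + 1 := Nat.lt_floor_add_one t
  have hmr : m < r := by exact_mod_cast hmt.trans_lt h1
  obtain ⟨q, rfl⟩ : ∃ q, r = (m + 1) + q := ⟨r - (m + 1), by omega⟩
  -- Distances rounded up: 1, ..., m + 1 to the left and 1, ..., q to the right. All are at least 1,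
  -- so omitting factors is harmless.
  let w : ℕ → ℕ := fun j => if j ≤ m then m + 1 - j else j - m
  have hw1 : ∀ j, 1 ≤ w j := fun j => by simp only [w]; split_ifs <;> omega
  have hw : ∀ j : ℕ, |t - j| ≤ (w j : ℝ) := by
    intro j
    simp only [w]
    split_ifs with h
    · have : (j : ℝ) ≤ m := by exact_mod_cast h
      rw [abs_of_nonneg (by linarith), Nat.cast_sub (by omega)]
      push_cast
      linarith
    · have : (m : ℝ) + 1 ≤ j := by exact_mod_cast (by omega : m + 1 ≤ j)
      rw [abs_of_nonpos (by linarith), Nat.cast_sub (by omega)]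
      linarith
  have hprod : ∏ j ∈ Finset.range (m + 1 + q), w j = (m + 1).factorial * q.factorial := by
    rw [Finset.prod_range_add, ← Finset.prod_range_add_one_eq_factorial,
      ← Finset.prod_range_add_one_eq_factorial, ← Finset.prod_range_reflect]
    congr 1
    · refine Finset.prod_congr rfl fun j hj => ?_
      have := Finset.mem_range.1 hj
      simp only [w]
      split_ifs <;> omega
    · refine Finset.prod_congr rfl fun j _ => ?_
      simp only [w]
      split_ifs <;> omega
  calc ∏ j ∈ s, |t - j| ≤ ∏ j ∈ s, (w j : ℝ) :=
        Finset.prod_le_prod (fun _ _ => abs_nonneg _) fun j _ => hw j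
    _ = ((∏ j ∈ s, w j : ℕ) : ℝ) := by push_cast; rfl
    _ ≤ ((m + 1 + q).factorial : ℝ) := by
        refine Nat.cast_le.2 ((Finset.prod_le_prod_of_subset_of_one_le' hs
          fun j _ _ => hw1 j).trans ?_)
        rw [hprod]
        exact Nat.le_of_dvd (Nat.factorial_pos _) (Nat.factorial_mul_factorial_dvd_factorial_add _ _)

theorem prod_erase_abs_sub_eq (i q : ℕ) :
    ∏ j ∈ (Finset.range (i + 1 + q)).erase i, |(i : ℝ) - j| = (i.factorial : ℝ) * q.factorial := by
  have h : ∏ j ∈ (Finset.range (i + 1 + q)).erase i, |(i : ℝ) - j| =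
      ∏ j ∈ Finset.range (i + 1 + q), (if j = i then 1 else |(i : ℝ) - j|) := by
    rw [← Finset.mul_prod_erase _ _ (Finset.mem_range.2 (by omega : i < i + 1 + q)), if_pos rfl,
      one_mul]
    exact Finset.prod_congr rfl fun j hj => by rw [if_neg (Finset.ne_of_mem_erase hj)]
  rw [h, Finset.prod_range_add, Finset.prod_range_succ, if_pos rfl, mul_one,
    ← Finset.prod_range_add_one_eq_factorial, ← Finset.prod_range_add_one_eq_factorial,
    ← Finset.prod_range_reflect]
  push_cast
  congr 1
  · refine Finset.prod_congr rfl fun j hj => ?_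
    have := Finset.mem_range.1 hj
    have h2 : ((i - 1 - j : ℕ) : ℝ) = i - 1 - j := by
      rw [Nat.cast_sub (by omega), Nat.cast_sub (by omega)]; simp
    have h3 : (j : ℝ) + 1 ≤ i := by exact_mod_cast this
    rw [if_neg (by omega), h2, show (i : ℝ) - (i - 1 - j) = j + 1 by ring, abs_of_nonneg]
    linarith [(Nat.cast_nonneg j : (0 : ℝ) ≤ j)]
  · refine Finset.prod_congr rfl fun j _ => ?_
    rw [if_neg (by omega), abs_sub_comm, abs_of_nonneg]
    · ring
    · linarith [(Nat.cast_nonneg j : (0 : ℝ) ≤ j)]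

/-- Bound for the Lagrange basis polynomials at consecutive integers. -/
theorem prod_erase_abs_div_le {r i : ℕ} (hi : i < r) {t : ℝ} (h0 : 0 ≤ t) (h1 : t < r) :
    ∏ j ∈ (Finset.range r).erase i, (|t - j| / |(i : ℝ) - j|) ≤ 4 ^ r := by
  rw [Finset.prod_div_distrib]
  have hnum := prod_abs_sub_le_factorial h0 h1 _ (Finset.erase_subset i (Finset.range r))
  obtain ⟨q, rfl⟩ : ∃ q, r = i + 1 + q := ⟨r - (i + 1), by omega⟩
  rw [prod_erase_abs_sub_eq, div_le_iff₀ (by positivity)]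
  refine hnum.trans ?_
  -- The ratio r!/(i! q!) equals (i + 1)·C(r, q), and both factors are at most 2^r.
  have h2 : (i + 1 + q).choose q ≤ 2 ^ (i + 1 + q) := Nat.choose_le_two_pow _ _
  have h3 : i + 1 ≤ 2 ^ (i + 1 + q) :=
    (by omega : i + 1 ≤ i + 1 + q).trans Nat.lt_two_pow_self.le
  have h4 := Nat.add_choose_mul_factorial_mul_factorial (i + 1) q
  have h5 : (i + 1 + q).factorial ≤ 4 ^ (i + 1 + q) * (i.factorial * q.factorial) := by
    rw [← h4, Nat.factorial_succ]
    calc (i + 1 + q).choose q * ((i + 1) * i.factorial) * q.factorial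
        = ((i + 1 + q).choose q * (i + 1)) * (i.factorial * q.factorial) := by ring
      _ ≤ (2 ^ (i + 1 + q) * 2 ^ (i + 1 + q)) * (i.factorial * q.factorial) := by gcongr
      _ = 4 ^ (i + 1 + q) * (i.factorial * q.factorial) := by
          rw [← mul_pow]; rfl
  exact_mod_cast h5

open Polynomial in
/-- If a polynomial is bounded by `1` at `r` consecutive integers, then around them it is bounded
up to the remainder of interpolation. -/
theorem Polynomial.abs_eval_le_of_window (p : ℝ[X]) {s r : ℕ} {n : ℝ} (hn : ((s + r : ℕ) : ℝ) ≤ n + 1)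
    (hp : ∀ j < r, |p.eval ((s + j : ℕ) : ℝ)| ≤ 1) {x : ℝ} (h0 : (s : ℝ) ≤ x)
    (h1 : x < ((s + r : ℕ) : ℝ)) (hxn : x ≤ n) {D : ℝ}
    (hD : ∀ y ∈ Set.Icc 0 n, |(derivative^[r] p).eval y| ≤ D) :
    |p.eval x| ≤ 8 ^ r + D := by
  classical
  have hinj : Function.Injective (fun j : ℕ => ((s + j : ℕ) : ℝ)) := fun a b h => by
    have : (s + a : ℕ) = s + b := by simpa using h
    omega
  set S : Finset ℝ := (Finset.range r).map ⟨_, hinj⟩ with hS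
  have hcard : S.card = r := by simp [hS]
  have ht0 : 0 ≤ x - s := by linarith
  have ht1 : x - s < r := by push_cast at h1; linarith
  have hx0 : x ∈ Set.Icc 0 n := ⟨(Nat.cast_nonneg s).trans h0, hxn⟩
  obtain ⟨ξ, hξ, h⟩ := p.exists_eval_sub_interpolate_eq S 0 n (by
    intro v hv
    simp only [hS, Finset.mem_map, Finset.mem_range, Function.Embedding.coeFn_mk] at hv
    obtain ⟨j, hj, rfl⟩ := hv
    refine ⟨Nat.cast_nonneg _, ?_⟩
    have : ((s + j + 1 : ℕ) : ℝ) ≤ ((s + r : ℕ) : ℝ) := by exact_mod_cast (by omega)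
    push_cast at this hn ⊢
    linarith) hx0
  rw [hcard] at h
  have hprod : |∏ v ∈ S, (x - v)| ≤ (r.factorial : ℝ) := by
    rw [Finset.abs_prod, hS, Finset.prod_map]
    refine le_trans (le_of_eq ?_) (prod_abs_sub_le_factorial ht0 ht1 _ subset_rfl)
    refine Finset.prod_congr rfl fun j _ => ?_
    simp only [Function.Embedding.coeFn_mk]
    push_cast
    congr 1
    ring
  have hrem : |(derivative^[r] p).eval ξ / (r.factorial : ℝ) * ∏ v ∈ S, (x - v)| ≤ D := by
    have hf : (0 : ℝ) < r.factorial := by positivity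
    rw [abs_mul, abs_div, abs_of_pos hf, div_mul_eq_mul_div, div_le_iff₀ hf]
    exact mul_le_mul (hD ξ hξ) hprod (abs_nonneg _) ((abs_nonneg _).trans (hD ξ hξ))
  have hL : |(Lagrange.interpolate S id (fun v => p.eval v)).eval x| ≤ 8 ^ r := by
    rw [Lagrange.interpolate_apply, eval_finsetSum]
    refine (Finset.abs_sum_le_sum_abs _ _).trans ?_
    rw [hS, Finset.sum_map]
    calc _ ≤ ∑ i ∈ Finset.range r, (4 : ℝ) ^ r := by
          refine Finset.sum_le_sum fun i hi => ?_
          have hi' := Finset.mem_range.1 hi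
          rw [eval_mul, eval_C, abs_mul]
          refine (mul_le_of_le_one_left (abs_nonneg _) (hp i hi')).trans ?_
          refine le_trans (le_of_eq ?_) (prod_erase_abs_div_le hi' ht0 ht1)
          rw [Lagrange.basis, eval_prod, Finset.abs_prod, ← Finset.map_erase, Finset.prod_map]
          refine Finset.prod_congr rfl fun j _ => ?_
          simp only [Function.Embedding.coeFn_mk, id, Lagrange.basisDivisor, eval_mul, eval_C,
            eval_sub, eval_X]
          rw [abs_mul, abs_inv, inv_mul_eq_div]
          push_cast
          congr 2 <;> ring
      _ = r * 4 ^ r := by simp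
      _ ≤ 2 ^ r * 4 ^ r := by
          gcongr
          exact_mod_cast Nat.lt_two_pow_self.le
      _ = 8 ^ r := by rw [← mul_pow]; norm_num
  have : p.eval x = (Lagrange.interpolate S id (fun v => p.eval v)).eval x +
      (derivative^[r] p).eval ξ / (r.factorial : ℝ) * ∏ v ∈ S, (x - v) := by linarith
  rw [this]
  exact (abs_add_le _ _).trans (add_le_add hL hrem)

/-- One term of the exponential series gives (6y)^r/r! ≤ e^{6y} ≤ e^r ≤ 3^r, so y^r/r! ≤ 2^{-r}. -/
theorem pow_div_factorial_le_half {y : ℝ} (hy : 0 ≤ y) {r : ℕ} (hr : 6 * y ≤ r) (h1 : 1 ≤ r) :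
    y ^ r / r.factorial ≤ 1 / 2 := by
  have h2 := Real.pow_div_factorial_le_exp (x := 6 * y) (by positivity) r
  have h3 : Real.exp (6 * y) ≤ 3 ^ r := by
    refine (Real.exp_le_exp.2 hr).trans ?_
    rw [← mul_one (r : ℝ), Real.exp_nat_mul]
    exact pow_le_pow_left₀ (Real.exp_pos _).le (by linarith [Real.exp_one_lt_d9]) r
  have h4 : (6 * y) ^ r / (r.factorial : ℝ) = 6 ^ r * (y ^ r / r.factorial) := by
    rw [mul_pow, mul_div_assoc]
  have h5 : (3 : ℝ) ^ r * 2 ≤ 6 ^ r := by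
    rw [show (6 : ℝ) = 3 * 2 by norm_num, mul_pow]
    gcongr
    exact le_self_pow₀ (by norm_num) (by omega)
  have h6 : (0 : ℝ) < 3 ^ r := by positivity
  have h7 : 0 ≤ y ^ r / (r.factorial : ℝ) := by positivity
  nlinarith

open Polynomial in
/-- The growth bound of Coppersmith and Rivlin for polynomials bounded at equally spaced points. -/
theorem Polynomial.abs_eval_le_of_abs_eval_natCast_le_one (p : ℝ[X]) {n : ℕ} (hn : 0 < n)
    (hd : p.natDegree ≤ n) (hp : ∀ k : ℕ, k ≤ n → |p.eval (k : ℝ)| ≤ 1) {x : ℝ}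
    (hx : x ∈ Set.Icc (0 : ℝ) n) :
    |p.eval x| ≤ 1024 * Real.exp (72 * (p.natDegree ^ 2 / n)) := by
  have hn' : (0 : ℝ) < n := by exact_mod_cast hn
  obtain ⟨x₀, hx₀, hmax⟩ := isCompact_Icc.exists_isMaxOn (s := Set.Icc (0 : ℝ) n)
    ⟨x, hx⟩ (f := fun t => |p.eval t|) p.continuous.abs.continuousOn
  have hM : ∀ u ∈ Set.Icc (0 : ℝ) n, |p.eval u| ≤ |p.eval x₀| := fun u hu => hmax hu
  refine (hM x hx).trans ?_
  set M := |p.eval x₀|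
  have hM0 : 0 ≤ M := abs_nonneg _
  set y : ℝ := 4 * p.natDegree ^ 2 / n with hy
  have hy0 : 0 ≤ y := by positivity
  set R := ⌈6 * y⌉₊ + 2 with hR
  set r := min R (n + 1) with hr
  have hr2 : 2 ≤ r := by omega
  have hder : ∀ v ∈ Set.Icc (0 : ℝ) n, |(derivative^[r] p).eval v| ≤ M / 2 := by
    intro v hv
    rcases le_total R (n + 1) with h | h
    · refine (p.abs_eval_iterate_derivative_le le_rfl r hn' hM hv).trans ?_
      have h6 : 6 * y ≤ r := by
        rw [hr, min_eq_left h]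
        exact (Nat.le_ceil _).trans (by exact_mod_cast (by omega))
      have := mul_le_mul_of_nonneg_left (pow_div_factorial_le_half hy0 h6 (by omega)) hM0
      linarith
    · rw [iterate_derivative_eq_zero (by omega)]
      simp only [eval_zero, abs_zero]
      linarith
  set m := ⌊x₀⌋₊
  have hm : (m : ℝ) ≤ x₀ := Nat.floor_le hx₀.1
  have hm' : x₀ < m + 1 := Nat.lt_floor_add_one x₀
  have hmn : m ≤ n := by exact_mod_cast hm.trans hx₀.2
  -- The window starts at ⌊x₀⌋, shifted left if it would leave [0, n].
  set s := min m (n + 1 - r) with hs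
  have hsr : s + r ≤ n + 1 := by omega
  have hwin := p.abs_eval_le_of_window (s := s) (r := r) (n := n) (by exact_mod_cast hsr)
    (fun j hj => hp _ (by omega)) (le_trans (by exact_mod_cast min_le_left _ _) hm)
    (by
      rcases le_total m (n + 1 - r) with h | h
      · refine hm'.trans_le ?_
        exact_mod_cast (by omega : m + 1 ≤ s + r)
      · have : ((n + 1 : ℕ) : ℝ) ≤ ((s + r : ℕ) : ℝ) := by exact_mod_cast (by omega)
        push_cast at this ⊢
        linarith [hx₀.2]) hx₀.2 hder
  have h8 : M ≤ 2 * 8 ^ r := by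
    have : M ≤ 8 ^ r + M / 2 := hwin
    linarith
  have hrR : (r : ℝ) ≤ 6 * y + 3 := by
    have h1 : (r : ℝ) ≤ R := by exact_mod_cast min_le_left _ _
    have h2 := Nat.ceil_lt_add_one (show 0 ≤ 6 * y by positivity)
    rw [hR] at h1
    push_cast at h1
    linarith
  -- From r ≤ 6y + 3: 2·8³ = 1024, and 8^{6y} ≤ e^{18y} with y = 4d²/n gives the exponent 72d²/n.
  have hexp3 : (8 : ℝ) ≤ Real.exp 3 := by
    rw [show (3 : ℝ) = (3 : ℕ) * 1 by norm_num, Real.exp_nat_mul]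
    refine le_trans (by norm_num) (pow_le_pow_left₀ (by norm_num)
      (by linarith [Real.add_one_le_exp (1 : ℝ)] : (2 : ℝ) ≤ Real.exp 1) 3)
  calc M ≤ 2 * 8 ^ r := h8
    _ = 2 * (8 : ℝ) ^ (r : ℝ) := by rw [Real.rpow_natCast]
    _ ≤ 2 * (8 : ℝ) ^ (6 * y + 3) := by
        gcongr
        norm_num
    _ = 1024 * (8 : ℝ) ^ (6 * y) := by
        rw [Real.rpow_add (by norm_num)]
        norm_num
        ring
    _ ≤ 1024 * (Real.exp 3) ^ (6 * y) := by gcongr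
    _ = 1024 * Real.exp (72 * (p.natDegree ^ 2 / n)) := by
        rw [← Real.exp_mul, hy]
        congr 2
        ring

theorem exists_isCoppersmithRivlinPair : ∃ a b : ℝ, IsCoppersmithRivlinPair a b := by
  -- 1025 instead of 1024 makes the inequality strict.
  refine ⟨1025, 72, by norm_num, by norm_num, ?_⟩
  rintro n d p δ rfl hd hp hδ hδn x hx0 hxn
  have he : 1 ≤ Real.exp (72 / δ) := Real.one_le_exp (by positivity)
  rcases Nat.eq_zero_or_pos n with rfl | hn
  · have : x = ((0 : ℕ) : ℝ) := le_antisymm hxn (by simpa using hx0)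
    rw [this]
    exact (hp 0 le_rfl).trans_lt (by linarith)
  · have hn' : (0 : ℝ) < n := by exact_mod_cast hn
    have h1 := p.abs_eval_le_of_abs_eval_natCast_le_one hn hd hp ⟨hx0, hxn⟩
    have h2 : (p.natDegree : ℝ) ^ 2 / n ≤ 1 / δ := by
      rw [div_le_div_iff₀ hn' hδ]
      linarith
    have h3 : Real.exp (72 * (p.natDegree ^ 2 / n)) ≤ Real.exp (72 / δ) := by
      refine Real.exp_le_exp.2 ?_
      rw [div_eq_mul_one_div (72 : ℝ)]
      linarith
    linarith

/-! ### Amplitudes as polynomials in the bits -/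

/-- The monomial `∏ i ∈ S, x_i` as a function of a list of bits. -/
noncomputable def bitMonomial {N : ℕ} (S : Finset (Fin N)) (X : Fin N → Bool) : ℂ :=
  if ∀ i ∈ S, X i = true then 1 else 0

/-- The functions of `N` bits which are polynomials of degree at most `t`. -/
noncomputable def bitPolynomials (N t : ℕ) : Submodule ℂ ((Fin N → Bool) → ℂ) :=
  Submodule.span ℂ (bitMonomial '' {S | S.card ≤ t})

theorem bitPolynomials_mono {N t t' : ℕ} (h : t ≤ t') :
    bitPolynomials N t ≤ bitPolynomials N t' :=
  Submodule.span_mono (Set.image_mono fun _ hS => le_trans hS h)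

theorem const_mem_bitPolynomials (N t : ℕ) (c : ℂ) : (fun _ => c) ∈ bitPolynomials N t := by
  have h : bitMonomial (∅ : Finset (Fin N)) ∈ bitPolynomials N t :=
    Submodule.subset_span ⟨∅, by simp, rfl⟩
  convert Submodule.smul_mem _ c h using 1
  ext X
  simp [bitMonomial]

/-- Bits are idempotent, so multiplying a monomial by x_i inserts `i` into its index set. -/
theorem bit_mul_mem_bitPolynomials {N t : ℕ} (i : Fin N) {f : (Fin N → Bool) → ℂ}
    (hf : f ∈ bitPolynomials N t) :
    (fun X => (if X i = true then 1 else 0) * f X) ∈ bitPolynomials N (t + 1) := by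
  classical
  refine Submodule.span_induction (p := fun f _ =>
    (fun X => (if X i = true then 1 else 0) * f X) ∈ bitPolynomials N (t + 1))
    ?_ ?_ ?_ ?_ hf
  · rintro _ ⟨S, hS, rfl⟩
    refine Submodule.subset_span ⟨insert i S, (Finset.card_insert_le _ _).trans (by simpa using hS),
      ?_⟩
    ext X
    simp only [bitMonomial, Finset.forall_mem_insert]
    by_cases h1 : X i = true <;> simp [h1]
  · simpa using const_mem_bitPolynomials N (t + 1) 0
  · intro f g _ _ h1 h2
    convert Submodule.add_mem _ h1 h2 using 1
    ext X
    simp [mul_add]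
  · intro c f _ h1
    convert Submodule.smul_mem _ c h1 using 1
    ext X
    simp only [Pi.smul_apply, smul_eq_mul]
    ring

theorem queryMap_queryMap {N : ℕ} (X : Fin N → Bool) {l m : ℕ} (k : QBasis l m) :
    queryMap X (queryMap X k) = k := by
  obtain ⟨j, b, z⟩ := k
  by_cases h : j.val < N <;> simp [queryMap, h]

theorem queryGate_mulVec {N : ℕ} (X : Fin N → Bool) {l m : ℕ} (ψ : QBasis l m → ℂ)
    (k : QBasis l m) : (queryGate X l m *ᵥ ψ) k = ψ (queryMap X k) := by
  rw [Matrix.mulVec, dotProduct, Finset.sum_eq_single (queryMap X k)]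
  · simp [queryGate, queryMap_queryMap]
  · intro k' _ hk'
    have : k ≠ queryMap X k' := fun h => hk' (by rw [h, queryMap_queryMap])
    simp [queryGate, this]
  · simp

/-- For j < N the new amplitude at (j, b, z) is (1 - x_j)ψ(j, b, z) + x_j ψ(j, ¬b, z). -/
theorem query_mem_bitPolynomials {N t l m : ℕ} {ψ : (Fin N → Bool) → QBasis l m → ℂ}
    (hψ : ∀ k, (fun X => ψ X k) ∈ bitPolynomials N t) (k : QBasis l m) :
    (fun X => (queryGate X l m *ᵥ ψ X) k) ∈ bitPolynomials N (t + 1) := by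
  simp only [queryGate_mulVec]
  obtain ⟨j, b, z⟩ := k
  by_cases h : j.val < N
  · have h1 := bitPolynomials_mono (Nat.le_succ t) (hψ (j, b, z))
    have h2 := bit_mul_mem_bitPolynomials ⟨j.val, h⟩ (hψ (j, b, z))
    have h3 := bit_mul_mem_bitPolynomials ⟨j.val, h⟩ (hψ (j, !b, z))
    convert Submodule.add_mem _ (Submodule.sub_mem _ h1 h2) h3 using 1
    ext X
    cases hX : X ⟨j.val, h⟩ <;> simp [queryMap, h, hX]
  · convert bitPolynomials_mono (Nat.le_succ t) (hψ (j, b, z)) using 1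
    ext X
    simp [queryMap, h]

theorem mulVec_mem_bitPolynomials {N t l m : ℕ} (U : Matrix (QBasis l m) (QBasis l m) ℂ)
    {ψ : (Fin N → Bool) → QBasis l m → ℂ}
    (hψ : ∀ k, (fun X => ψ X k) ∈ bitPolynomials N t) (k : QBasis l m) :
    (fun X => (U *ᵥ ψ X) k) ∈ bitPolynomials N t := by
  have : (fun X => (U *ᵥ ψ X) k) = ∑ k', U k k' • fun X => ψ X k' := by
    ext X
    simp [Matrix.mulVec, dotProduct]
  rw [this]
  exact Submodule.sum_mem _ fun k' _ => Submodule.smul_mem _ _ (hψ k')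

/-- After `t` queries the amplitudes are polynomials of degree at most `t` in the bits. -/
theorem QueryAlgorithm.state_mem_bitPolynomials {N T : ℕ} {α : Type} (A : QueryAlgorithm N T α)
    (t : Fin (T + 1)) (k : QBasis A.l A.m) :
    (fun X => A.state X t k) ∈ bitPolynomials N t := by
  induction t using Fin.induction generalizing k with
  | zero => exact const_mem_bitPolynomials N _ _
  | succ i ih =>
    simp only [QueryAlgorithm.state, Fin.induction_succ]
    exact mulVec_mem_bitPolynomials _ (fun k => query_mem_bitPolynomials (fun k => ih k) k) k

theorem sum_norm_sq_unitary_mulVec {ι : Type*} [Fintype ι] [DecidableEq ι]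
    (U : Matrix.unitaryGroup ι ℂ) (ψ : ι → ℂ) :
    ∑ k, ‖((U : Matrix ι ι ℂ) *ᵥ ψ) k‖ ^ 2 = ∑ k, ‖ψ k‖ ^ 2 := by
  have key : ∀ φ : ι → ℂ, ((∑ k, ‖φ k‖ ^ 2 : ℝ) : ℂ) = star φ ⬝ᵥ φ := fun φ => by
    simp only [dotProduct, Pi.star_apply, RCLike.star_def, Complex.conj_mul']
    push_cast
    rfl
  have hU : (U : Matrix ι ι ℂ)ᴴ * (U : Matrix ι ι ℂ) = 1 := Matrix.UnitaryGroup.star_mul_self U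
  rw [← Complex.ofReal_inj, key, key, Matrix.star_mulVec, Matrix.dotProduct_mulVec,
    Matrix.vecMul_vecMul, hU, Matrix.vecMul_one]

theorem QueryAlgorithm.sum_norm_sq_state {N T : ℕ} {α : Type} (A : QueryAlgorithm N T α)
    (X : Fin N → Bool) (t : Fin (T + 1)) : ∑ k, ‖A.state X t k‖ ^ 2 = 1 := by
  induction t using Fin.induction with
  | zero =>
    simp only [QueryAlgorithm.state, Fin.induction_zero]
    rw [sum_norm_sq_unitary_mulVec, Finset.sum_eq_single (QBasis.zero A.l A.m)]
    · simp
    · intro k _ hk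
      simp [hk]
    · simp
  | succ i ih =>
    rw [← ih]
    simp only [QueryAlgorithm.state, Fin.induction_succ]
    rw [sum_norm_sq_unitary_mulVec]
    simp only [queryGate_mulVec]
    exact Equiv.sum_comp (Function.Involutive.toPerm (queryMap X) (queryMap_queryMap X))
      (fun k => ‖A.state X i.castSucc k‖ ^ 2)

/-! ### Symmetrization -/

/-- The list of bits with ones exactly at the positions in `S`. -/
def bitsOfFinset {N : ℕ} (S : Finset (Fin N)) : Fin N → Bool := fun i => decide (i ∈ S)

/-- Count the k-sets containing `S`. The average of the monomial is thus a ratio of falling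
factorials, a polynomial in k of degree |S|. -/
theorem sum_bitMonomial_powersetCard (N k : ℕ) (S : Finset (Fin N)) :
    (N.descFactorial S.card : ℂ) *
      ∑ W ∈ Finset.powersetCard k Finset.univ, bitMonomial S (bitsOfFinset W) =
    N.choose k * k.descFactorial S.card := by
  have h1 : ∑ W ∈ Finset.powersetCard k Finset.univ, bitMonomial S (bitsOfFinset W) =
      (((Finset.powersetCard k (Finset.univ : Finset (Fin N))).filter (S ⊆ ·)).card : ℂ) := by
    rw [Finset.card_filter]
    push_cast
    refine Finset.sum_congr rfl fun W _ => ?_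
    simp [bitMonomial, bitsOfFinset, Finset.subset_iff]
  have hSN : S.card ≤ N := by simpa using S.card_le_univ
  rw [h1]
  by_cases hSk : S.card ≤ k
  · have h2 : ((Finset.powersetCard k (Finset.univ : Finset (Fin N))).filter (S ⊆ ·)).card =
        (N - S.card).choose (k - S.card) := by
      have : (Finset.powersetCard (k - S.card) Sᶜ).card = (N - S.card).choose (k - S.card) := by
        rw [Finset.card_powersetCard, Finset.card_compl, Fintype.card_fin]
      rw [← this]
      refine Finset.card_bij' (fun W _ => W \ S) (fun V _ => S ∪ V) ?_ ?_ ?_ ?_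
      · intro W hW
        simp only [Finset.mem_filter, Finset.mem_powersetCard] at hW ⊢
        refine ⟨fun i hi => by simpa using (Finset.mem_sdiff.1 hi).2, ?_⟩
        rw [Finset.card_sdiff_of_subset hW.2, hW.1.2]
      · intro V hV
        simp only [Finset.mem_filter, Finset.mem_powersetCard] at hV ⊢
        have hd : Disjoint S V := (Finset.disjoint_left.2 fun i hi hiV => by
          simpa [hi] using hV.1 hiV)
        exact ⟨⟨Finset.subset_univ _, by rw [Finset.card_union_of_disjoint hd, hV.2]; omega⟩,
          Finset.subset_union_left⟩
      · intro W hW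
        exact Finset.union_sdiff_of_subset (Finset.mem_filter.1 hW).2
      · intro V hV
        have hV' := Finset.mem_powersetCard.1 hV
        have hd : Disjoint S V := (Finset.disjoint_left.2 fun i hi hiV => by
          simpa [hi] using hV'.1 hiV)
        exact Finset.union_sdiff_cancel_left hd
    have h3 := Nat.choose_mul (n := N) hSk
    rw [h2, Nat.descFactorial_eq_factorial_mul_choose, Nat.descFactorial_eq_factorial_mul_choose]
    norm_cast
    calc _ = S.card.factorial * (N.choose S.card * (N - S.card).choose (k - S.card)) := by ring
      _ = _ := by rw [← h3]; ring
  · have h2 : (Finset.powersetCard k (Finset.univ : Finset (Fin N))).filter (S ⊆ ·) = ∅ := by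
      refine Finset.filter_eq_empty_iff.2 fun W hW hSW => hSk ?_
      rw [← (Finset.mem_powersetCard.1 hW).2]
      exact Finset.card_le_card hSW
    rw [h2, Nat.descFactorial_eq_zero_iff_lt.2 (not_le.1 hSk)]
    simp

open Polynomial in
/-- Symmetrization: averages of a polynomial over the lists with `k` ones are values at `k` of a
univariate polynomial of at most the same degree. -/
theorem exists_polynomial_of_mem_bitPolynomials {N t : ℕ} {f : (Fin N → Bool) → ℂ}
    (hf : f ∈ bitPolynomials N t) :
    ∃ q : ℝ[X], q.natDegree ≤ t ∧ ∀ k ≤ N,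
      (N.choose k : ℝ) * q.eval (k : ℝ) =
        ∑ W ∈ Finset.powersetCard k Finset.univ, (f (bitsOfFinset W)).re := by
  -- Real parts do not commute with complex scalars, so the span induction carries an arbitrary
  -- factor `c`.
  suffices h : ∀ c : ℂ, ∃ q : ℝ[X], q.natDegree ≤ t ∧ ∀ k ≤ N,
      (N.choose k : ℝ) * q.eval (k : ℝ) =
        ∑ W ∈ Finset.powersetCard k Finset.univ, (c * f (bitsOfFinset W)).re by
    simpa using h 1
  refine Submodule.span_induction (p := fun f _ => ∀ c : ℂ, ∃ q : ℝ[X], q.natDegree ≤ t ∧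
    ∀ k ≤ N, (N.choose k : ℝ) * q.eval (k : ℝ) =
        ∑ W ∈ Finset.powersetCard k Finset.univ, (c * f (bitsOfFinset W)).re) ?_ ?_ ?_ ?_ hf
  · rintro _ ⟨S, hS, rfl⟩ c
    have hSN : S.card ≤ N := by simpa using S.card_le_univ
    have hpos : (N.descFactorial S.card : ℝ) ≠ 0 := by
      exact_mod_cast (Nat.descFactorial_pos.2 hSN).ne'
    refine ⟨C (c.re / N.descFactorial S.card) * descPochhammer ℝ S.card,
      (natDegree_C_mul_le _ _).trans ((descPochhammer_natDegree ℝ _).le.trans hS), ?_⟩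
    intro k hk
    have h := congrArg (fun z => (c * z).re) (sum_bitMonomial_powersetCard N k S)
    rw [eval_mul, eval_C, descPochhammer_eval_eq_descFactorial, ← Complex.re_sum, ← Finset.mul_sum]
    rw [mul_left_comm, ← Complex.ofReal_natCast (N.descFactorial S.card), Complex.re_ofReal_mul,
      ← Nat.cast_mul, ← Complex.ofReal_natCast (_ * _), Complex.re_mul_ofReal] at h
    push_cast at h
    field_simp
    linarith
  · intro c
    exact ⟨0, by simp, by simp⟩
  · intro f g _ _ h1 h2 c
    obtain ⟨q1, hq1, e1⟩ := h1 c
    obtain ⟨q2, hq2, e2⟩ := h2 c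
    refine ⟨q1 + q2, (natDegree_add_le _ _).trans (max_le hq1 hq2), fun k hk => ?_⟩
    rw [eval_add, mul_add, e1 k hk, e2 k hk, ← Finset.sum_add_distrib]
    simp [mul_add]
  · intro a f _ h c
    obtain ⟨q, hq, e⟩ := h (c * a)
    refine ⟨q, hq, fun k hk => ?_⟩
    rw [e k hk]
    simp only [Pi.smul_apply, smul_eq_mul, mul_assoc]

/-! ### The separating polynomial of a network -/

theorem QueryAlgorithm.outputProb_nonneg {N T : ℕ} {α : Type} (A : QueryAlgorithm N T α)
    (X : Fin N → Bool) (S : Set α) : 0 ≤ A.outputProb X S :=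
  Finset.sum_nonneg fun _ _ => Set.indicator_nonneg (fun _ _ => sq_nonneg _) _

theorem QueryAlgorithm.outputProb_mono {N T : ℕ} {α : Type} (A : QueryAlgorithm N T α)
    (X : Fin N → Bool) {S S' : Set α} (h : S ⊆ S') : A.outputProb X S ≤ A.outputProb X S' :=
  Finset.sum_le_sum fun _ _ => Set.indicator_le_indicator_of_subset (Set.preimage_mono h)
    (fun _ => sq_nonneg _) _

open Polynomial in
/-- A network for OR yields a polynomial of degree at most `T` which nearly separates `0` from
`1, ..., N`. It comes from the overlap of the final states on the zero list and on the list `X`,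
projected to the outcomes with answer `false`. -/
theorem QueryAlgorithm.ComputesOr.exists_polynomial {N T : ℕ} {A : QueryAlgorithm N T Bool} {ε : ℝ}
    (hA : A.ComputesOr ε) :
    ∃ q : ℝ[X], q.natDegree ≤ T ∧ 1 - ε ≤ q.eval 0 ∧
      ∀ k : ℕ, 1 ≤ k → k ≤ N → |q.eval (k : ℝ)| ≤ √ε := by
  classical
  set ψ : (Fin N → Bool) → QBasis A.l A.m → ℂ := fun X => A.state X (Fin.last T) with hψ
  set X₀ : Fin N → Bool := fun _ => false with hX₀
  set B : Finset (QBasis A.l A.m) := Finset.univ.filter (fun k => A.out k = false) with hB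
  have hprob : ∀ (X : Fin N → Bool) (v : Bool), A.outputProb X {w | w ≠ !v} =
      ∑ k ∈ Finset.univ.filter (fun k => A.out k = v), ‖ψ X k‖ ^ 2 := by
    intro X v
    rw [QueryAlgorithm.outputProb, Finset.sum_filter]
    refine Finset.sum_congr rfl fun k _ => ?_
    simp only [Set.indicator, Set.mem_preimage, Set.mem_ofPred_eq, hψ]
    cases A.out k <;> cases v <;> simp
  have hle : ∀ X : Fin N → Bool, X ≠ X₀ → ∑ k ∈ B, ‖ψ X k‖ ^ 2 ≤ ε := by
    intro X hX
    have hor : boolOr X = true := by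
      simp only [boolOr, decide_eq_true_eq]
      by_contra! h
      exact hX (funext fun j => by simpa using h j)
    have := hA X
    rw [hor] at this
    rw [hB, ← hprob X false]
    simpa using this
  set s := ∑ k ∈ B, ‖ψ X₀ k‖ ^ 2 with hs
  have htot : s + ∑ k ∈ Finset.univ.filter (fun k => A.out k = true), ‖ψ X₀ k‖ ^ 2 = 1 := by
    rw [← A.sum_norm_sq_state X₀ (Fin.last T), hs, hB,
      ← Finset.sum_filter_add_sum_filter_not Finset.univ (fun k => A.out k = false)]
    simp only [Bool.not_eq_false]
    rfl
  have hs1 : 1 - ε ≤ s := by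
    have hor : boolOr X₀ = false := by simp [boolOr, hX₀]
    have := hA X₀
    rw [hor] at this
    have h2 := hprob X₀ true
    simp only [Bool.not_true] at h2
    linarith
  have hs2 : s ≤ 1 := by
    have : 0 ≤ ∑ k ∈ Finset.univ.filter (fun k => A.out k = true), ‖ψ X₀ k‖ ^ 2 :=
      Finset.sum_nonneg fun _ _ => sq_nonneg _
    linarith
  set f : (Fin N → Bool) → ℂ := fun X => ∑ k ∈ B, star (ψ X₀ k) * ψ X k with hf
  have hfmem : f ∈ bitPolynomials N T := by
    have : f = ∑ k ∈ B, star (ψ X₀ k) • fun X => ψ X k := by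
      ext X
      simp [hf]
    rw [this]
    refine Submodule.sum_mem _ fun k _ => Submodule.smul_mem _ _ ?_
    simpa using A.state_mem_bitPolynomials (Fin.last T) k
  have hf0 : (f X₀).re = s := by
    have : f X₀ = (s : ℂ) := by
      simp only [hf, hs, RCLike.star_def, Complex.conj_mul']
      push_cast
      rfl
    rw [this, Complex.ofReal_re]
  -- Cauchy–Schwarz: the projected states have norms at most 1 and √ε.
  have hfX : ∀ X : Fin N → Bool, X ≠ X₀ → |(f X).re| ≤ √ε := by
    intro X hX
    refine (Complex.abs_re_le_norm _).trans ?_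
    refine (norm_sum_le _ _).trans ?_
    simp only [norm_mul, norm_star]
    refine (Real.sum_mul_le_sqrt_mul_sqrt _ _ _).trans ?_
    calc _ ≤ √1 * √ε := mul_le_mul (Real.sqrt_le_sqrt hs2) (Real.sqrt_le_sqrt (hle X hX))
          (Real.sqrt_nonneg _) (Real.sqrt_nonneg _)
      _ = √ε := by simp
  obtain ⟨q, hq, hval⟩ := exists_polynomial_of_mem_bitPolynomials hfmem
  refine ⟨q, hq, ?_, fun k hk1 hkN => ?_⟩
  · have h := hval 0 (Nat.zero_le _)
    have h0 : bitsOfFinset (∅ : Finset (Fin N)) = X₀ := by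
      ext i
      simp [bitsOfFinset, hX₀]
    simp only [Nat.choose_zero_right, Nat.cast_one, one_mul, Nat.cast_zero,
      Finset.powersetCard_zero, Finset.sum_singleton, h0, hf0] at h
    rw [h]
    exact hs1
  · have hpos : (0 : ℝ) < N.choose k := by exact_mod_cast Nat.choose_pos hkN
    refine le_of_mul_le_mul_left ?_ hpos
    rw [← abs_of_pos hpos, ← abs_mul, abs_of_pos hpos, hval k hkN]
    refine (Finset.abs_sum_le_sum_abs _ _).trans ?_
    refine (Finset.sum_le_card_nsmul _ _ (√ε) fun W hW => hfX _ fun h => ?_).trans_eq ?_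
    · have hW' : W = ∅ := by
        refine Finset.eq_empty_of_forall_notMem fun i hi => ?_
        have := congrFun h i
        simp [bitsOfFinset, hX₀, hi] at this
      have := (Finset.mem_powersetCard.1 hW).2
      rw [hW', Finset.card_empty] at this
      omega
    · simp [Finset.card_powersetCard]

/-! ### Extrapolation and the lower bound -/

open Polynomial in
/-- A polynomial bounded on `[0, n]` grows slowly to the next integer. -/
theorem Polynomial.abs_eval_add_one_le (p : ℝ[X]) {T n : ℕ} (hn : 1 ≤ n) (hd : p.natDegree ≤ T)
    {M : ℝ} (hp : ∀ x ∈ Set.Icc (0 : ℝ) n, |p.eval x| ≤ M) :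
    |p.eval (n + 1 : ℝ)| ≤ M * Real.exp (4 * T / √(n + 1 : ℝ)) := by
  have hn' : (1 : ℝ) ≤ n := by exact_mod_cast hn
  have hn0 : (0 : ℝ) < n := by linarith
  have hM : 0 ≤ M := (abs_nonneg _).trans (hp 0 ⟨le_rfl, hn0.le⟩)
  set s := √(n + 1 : ℝ) with hs
  have hs2 : s ^ 2 = n + 1 := Real.sq_sqrt (by linarith)
  have hs0 : 0 < s := Real.sqrt_pos.2 (by linarith)
  -- Rescaling [0, n] to [-1, 1] sends n + 1 to (n + 2)/n = cosh t, where T_d(cosh t) = cosh(dt).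
  set t := Real.arsinh (2 * s / n) with ht
  have hcosh : Real.cosh t = (n + 2) / n := by
    rw [Real.cosh_arsinh, Real.sqrt_eq_iff_mul_self_eq (by positivity) (by positivity)]
    field_simp
    nlinarith
  have ht0 : 0 ≤ t := Real.arsinh_nonneg_iff.2 (by positivity)
  have htle : t ≤ 4 / s := by
    have h1 : t ≤ Real.sinh t := Real.self_le_sinh_iff.2 ht0
    rw [Real.sinh_arsinh] at h1
    refine h1.trans ?_
    rw [div_le_div_iff₀ hn0 hs0]
    nlinarith
  have h := p.abs_eval_iterate_derivative_le_chebyshev hd 0 (c := (n : ℝ) / 2) (e := (n : ℝ) / 2)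
    hM (fun u hu => hp _ ⟨by nlinarith [hu.1], by nlinarith [hu.2]⟩) (x := Real.cosh t)
    (Real.one_le_cosh t)
  simp only [pow_zero, one_mul, Function.iterate_zero, id, Chebyshev.T_real_cosh] at h
  rw [hcosh, show (n : ℝ) / 2 * ((n + 2) / n) + n / 2 = n + 1 by field_simp; ring] at h
  refine h.trans (mul_le_mul_of_nonneg_left ?_ hM)
  have hTt : 0 ≤ (T : ℝ) * t := by positivity
  calc Real.cosh (((T : ℤ) : ℝ) * t) ≤ Real.exp (T * t) := by
        rw [Int.cast_natCast, Real.cosh_eq]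
        have : Real.exp (-(T * t)) ≤ Real.exp (T * t) := Real.exp_le_exp.2 (by linarith)
        linarith
    _ ≤ Real.exp (4 * T / s) := by
        refine Real.exp_le_exp.2 ?_
        calc (T : ℝ) * t ≤ T * (4 / s) := by gcongr
          _ = 4 * T / s := by ring

-- Divide by `M` and take δ = n/(T² + 1). The 1 keeps δ valid for T = 0 and costs e^{b/n} ≤ e^b.
open Polynomial in
theorem IsCoppersmithRivlinPair.abs_eval_le {a b : ℝ} (hab : IsCoppersmithRivlinPair a b)
    (p : ℝ[X]) {T n : ℕ} (hn : 1 ≤ n) (hd : p.natDegree ≤ T) (hT : T ≤ n) {M : ℝ} (hM : 0 < M)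
    (hp : ∀ k : ℕ, k ≤ n → |p.eval (k : ℝ)| ≤ M) {x : ℝ} (hx : x ∈ Set.Icc (0 : ℝ) n) :
    |p.eval x| ≤ M * (a * Real.exp b * Real.exp (b * T ^ 2 / n)) := by
  obtain ⟨ha, hb, h⟩ := hab
  have hn' : (1 : ℝ) ≤ n := by exact_mod_cast hn
  have hn0 : (0 : ℝ) < n := by linarith
  have hdeg : (C M⁻¹ * p).natDegree ≤ T := (natDegree_C_mul_le _ _).trans hd
  have hscale : ∀ y, |(C M⁻¹ * p).eval y| = |p.eval y| / M := fun y => by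
    rw [eval_mul, eval_C, abs_mul, abs_inv, abs_of_pos hM, inv_mul_eq_div]
  have h1 := h n _ (C M⁻¹ * p) (n / (T ^ 2 + 1)) rfl (hdeg.trans hT)
    (fun k hk => by rw [hscale, div_le_one hM]; exact hp k hk) (by positivity)
    (by
      have : ((C M⁻¹ * p).natDegree : ℝ) ≤ T := by exact_mod_cast hdeg
      rw [div_mul_eq_mul_div, div_le_iff₀ (by positivity)]
      refine mul_le_mul_of_nonneg_left ?_ hn0.le
      have := pow_le_pow_left₀ (Nat.cast_nonneg _) this 2
      linarith) x hx.1 hx.2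
  rw [hscale, div_lt_iff₀' hM] at h1
  refine h1.le.trans (mul_le_mul_of_nonneg_left ?_ hM.le)
  rw [mul_assoc, ← Real.exp_add]
  refine mul_le_mul_of_nonneg_left (Real.exp_le_exp.2 ?_) ha.le
  have : b / n ≤ b := div_le_self hb.le hn'
  calc b / (n / (T ^ 2 + 1)) = b / n + b * T ^ 2 / n := by field_simp; ring
    _ ≤ b + b * T ^ 2 / n := by linarith

open Polynomial in
theorem QueryAlgorithm.ComputesOr.le_of_pos {a b : ℝ} (hab : IsCoppersmithRivlinPair a b)
    {N T : ℕ} (hT : T < N) {ε : ℝ} (hε : 0 < ε) {A : QueryAlgorithm N T Bool}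
    (hA : A.ComputesOr ε) :
    min (1 / 4) (9 / 16 / (a * Real.exp b) ^ 2) *
      Real.exp (-4 * b * (T : ℝ) ^ 2 / (N : ℝ) - 8 * (T : ℝ) / √(N : ℝ)) ≤ ε := by
  have ha := hab.1
  have hb := hab.2.1
  set E := 4 * b * (T : ℝ) ^ 2 / (N : ℝ) + 8 * (T : ℝ) / √(N : ℝ) with hE
  have hE0 : 0 ≤ E := by positivity
  have hneg : -4 * b * (T : ℝ) ^ 2 / (N : ℝ) - 8 * (T : ℝ) / √(N : ℝ) = -E := by rw [hE]; ring
  rw [hneg]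
  rcases le_or_gt (1 / 4) ε with h4 | h4
  · refine le_trans ?_ h4
    refine (mul_le_of_le_one_right (by positivity) (Real.exp_le_one_iff.2 (by linarith))).trans
      (min_le_left _ _)
  obtain ⟨q, hq, hq0, hqk⟩ := hA.exists_polynomial
  have hsε : 0 < √ε := Real.sqrt_pos.2 hε
  obtain ⟨n, rfl⟩ : ∃ n, N = n + 1 := ⟨N - 1, by omega⟩
  rcases Nat.eq_zero_or_pos n with rfl | hn
  · exfalso
    have hconst : q.natDegree = 0 := by omega
    have h1 := hqk 1 le_rfl le_rfl
    rw [eq_C_of_natDegree_eq_zero hconst] at h1 hq0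
    rw [eval_C] at h1 hq0
    have h2 := (le_abs_self _).trans h1
    nlinarith [Real.sq_sqrt hε.le]
  have hn' : (1 : ℝ) ≤ n := by exact_mod_cast hn
  have hn0 : (0 : ℝ) < n := by linarith
  -- Reflection puts the small values at 0, ..., n and the large one at n + 1.
  set r : ℝ[X] := q.comp (C (-1) * X + C (n + 1 : ℝ)) with hr
  have hre : ∀ y, r.eval y = q.eval (n + 1 - y) := fun y => by
    simp only [hr, eval_comp, eval_add, eval_mul, eval_C, eval_X]
    congr 1
    ring
  have hrd : r.natDegree ≤ T := by
    refine natDegree_comp_le.trans ((Nat.mul_le_mul hq natDegree_linear_le).trans ?_)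
    simp
  have hcr := fun x (hx : x ∈ Set.Icc (0 : ℝ) n) => hab.abs_eval_le r hn hrd (by omega) hsε
    (fun k hk => by
      have := hqk (n + 1 - k) (by omega) (by omega)
      rw [Nat.cast_sub (by omega)] at this
      rw [hre]
      push_cast at this
      exact this) hx
  have hfin := r.abs_eval_add_one_le hn hrd hcr
  rw [hre, sub_self] at hfin
  have h34 : 3 / 4 ≤ √ε * (a * Real.exp b * Real.exp (b * T ^ 2 / n)) *
      Real.exp (4 * T / √(n + 1 : ℝ)) := by
    have := (le_abs_self _).trans hfin
    linarith
  have hsq : Real.exp (b * T ^ 2 / n) ^ 2 * Real.exp (4 * T / √(n + 1 : ℝ)) ^ 2 ≤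
      Real.exp E := by
    rw [← Real.exp_nat_mul, ← Real.exp_nat_mul, ← Real.exp_add]
    refine Real.exp_le_exp.2 ?_
    -- Replacing n by N = n + 1 ≤ 2n doubles the coefficient.
    have h1 : 2 * (b * (T : ℝ) ^ 2 / n) ≤ 4 * b * T ^ 2 / (n + 1) := by
      rw [← mul_div_assoc, div_le_div_iff₀ hn0 (by positivity)]
      have : 0 ≤ b * (T : ℝ) ^ 2 := by positivity
      nlinarith
    have h2 : 2 * (4 * (T : ℝ) / √(n + 1 : ℝ)) = 8 * T / √(n + 1 : ℝ) := by ring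
    rw [hE]
    push_cast
    linarith
  have h916 : 9 / 16 ≤ ε * ((a * Real.exp b) ^ 2 * Real.exp E) := by
    calc (9 / 16 : ℝ) = (3 / 4) ^ 2 := by norm_num
      _ ≤ (√ε * (a * Real.exp b * Real.exp (b * T ^ 2 / n)) *
            Real.exp (4 * T / √(n + 1 : ℝ))) ^ 2 := pow_le_pow_left₀ (by norm_num) h34 2
      _ = ε * ((a * Real.exp b) ^ 2 *
            (Real.exp (b * T ^ 2 / n) ^ 2 * Real.exp (4 * T / √(n + 1 : ℝ)) ^ 2)) := by
          rw [mul_pow, mul_pow, Real.sq_sqrt hε.le, mul_pow]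
          ring
      _ ≤ ε * ((a * Real.exp b) ^ 2 * Real.exp E) := by gcongr
  calc min (1 / 4) (9 / 16 / (a * Real.exp b) ^ 2) * Real.exp (-E)
      ≤ 9 / 16 / (a * Real.exp b) ^ 2 * Real.exp (-E) := by
        gcongr
        exact min_le_right _ _
    _ = 9 / 16 / ((a * Real.exp b) ^ 2 * Real.exp E) := by
        rw [Real.exp_neg, ← div_eq_mul_inv, div_div]
    _ ≤ ε := by rwa [div_le_iff₀ (by positivity)]

theorem QueryAlgorithm.ComputesOr.mono {N T : ℕ} {A : QueryAlgorithm N T Bool} {ε ε' : ℝ}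
    (hA : A.ComputesOr ε) (h : ε ≤ ε') : A.ComputesOr ε' := fun X => (hA X).trans h

/-- Scaling by √ε needs ε > 0; the case ε = 0 follows by applying the bound to ε + η for all η > 0.
-/
theorem QueryAlgorithm.ComputesOr.le {a b : ℝ} (hab : IsCoppersmithRivlinPair a b)
    {N T : ℕ} (hT : T < N) {ε : ℝ} {A : QueryAlgorithm N T Bool} (hA : A.ComputesOr ε) :
    min (1 / 4) (9 / 16 / (a * Real.exp b) ^ 2) *
      Real.exp (-4 * b * (T : ℝ) ^ 2 / (N : ℝ) - 8 * (T : ℝ) / √(N : ℝ)) ≤ ε := by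
  have hε : 0 ≤ ε := (A.outputProb_nonneg _ _).trans (hA fun _ => false)
  exact le_of_forall_pos_le_add fun η hη =>
    (hA.mono (le_add_of_nonneg_right hη.le)).le_of_pos hab hT (by linarith)

/-! ### Reduction from search to OR -/

/-- The network for OR which asks whether a search algorithm finds a solution. -/
def QueryAlgorithm.searchToOr {N T : ℕ} (A : QueryAlgorithm N T (Option (Fin N))) :
    QueryAlgorithm N T Bool where
  l := A.l
  m := A.m
  index_large := A.index_large
  U := A.U
  out := fun k => (A.out k).isSome

theorem QueryAlgorithm.Searches.computesOr {N T : ℕ} {A : QueryAlgorithm N T (Option (Fin N))}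
    {ε : ℝ} (hA : A.Searches ε) : A.searchToOr.ComputesOr ε := by
  intro X
  refine le_trans ?_ (hA X)
  change A.outputProb X {v | v.isSome ≠ boolOr X} ≤ _
  refine A.outputProb_mono X fun v hv hans => hv ?_
  cases v with
  | none =>
    have : ∀ j, X j = false := hans
    simp [boolOr, this]
  | some j =>
    have : X j = true := hans
    simpa [boolOr] using ⟨j, this⟩

theorem theorem2 :
    (∃ a b : ℝ, IsCoppersmithRivlinPair a b) ∧
    ∀ a b : ℝ, IsCoppersmithRivlinPair a b →
      ∃ c : ℝ, 0 < c ∧ ∀ N T : ℕ, T < N → ∀ ε : ℝ,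
        (∀ A : QueryAlgorithm N T Bool, A.ComputesOr ε →
          c * Real.exp (-4 * b * (T : ℝ) ^ 2 / (N : ℝ) - 8 * (T : ℝ) / √(N : ℝ)) ≤ ε) ∧
        (∀ A : QueryAlgorithm N T (Option (Fin N)), A.Searches ε →
          c * Real.exp (-4 * b * (T : ℝ) ^ 2 / (N : ℝ) - 8 * (T : ℝ) / √(N : ℝ)) ≤ ε) := by
  refine ⟨exists_isCoppersmithRivlinPair, fun a b hab => ?_⟩
  have ha := hab.1
  exact ⟨min (1 / 4) (9 / 16 / (a * Real.exp b) ^ 2), lt_min (by norm_num) (by positivity),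
    fun N T hT ε => ⟨fun A hA => hA.le hab hT, fun A hA => hA.computesOr.le hab hT⟩⟩
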